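/- Let $K$ be an algebraically closed field, $X$ a finite set of variables, $H,T\subseteq K[X]$ ideals, and $U\subseteq X$ a set of variables that is independent for $H$, i.e. $H\cap K[U]=(0)$, with $|U|=\dim K[X]/H$ (Krull dimension). Fix a monomial order on the variables $X\setminus U$, and regard the ideal $H+T$ as an ideal $I$ of $K[U][X\setminus U]$, with the variables in $U$ as parameters; for $u\in K^U$ let $\sigma_u:K[U][X\setminus U]\to K[X\setminus U]$ denote the specialization of the parameters at $u$. A *minimal canonical comprehensive Gröbner system* (MCCGS) of $\{H,T\}$ with respect to $U$ is a finite set of pairs $(S_i,B_i)$ such that: the $S_i$ (the segments) are nonempty constructible sets that partition $K^U$; each $B_i\subset K[U][X\setminus U]$ is a finite set of polynomials with content $1$ over $K[U]$ (polynomials being taken up to nonzero constants of $K$) and pairwise distinct leading power products, whose leading coefficients vanish at no point of $S_i$, and such that for every $u\in S_i$ the polynomials of $\sigma_u(B_i)$, made monic, form the reduced Gröbner basis of $\sigma_u(I)$; and the number of segments is the least possible among all systems with these properties. A segment is *generic* if it contains a nonempty Zariski-open subset of $K^U$. Then the following hold. 1. $T$ vanishes identically on some irreducible component $C$ of $\mathbb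 V(H)\subseteq K^X$ on which $U$ is independent (no nonzero polynomial of $K[U]$ vanishes on $C$) if and only if $(H+T)\cap K[U]=(0)$. 2. Every MCCGS of $\{H,T\}$ with respect to $U$ has exactly one generic segment, and $T$ vanishes identically on some irreducible component of $\mathbb V(H)$ on which $U$ is independent if and only if the basis $B$ of the generic segment is different from $1$, i.e. $B$ is not of the form $\{c\}$ with $c\in K\setminus\{0\}$. -/

import Mathlib

open MvPolynomial

noncomputable section

namespace ParametricGroebner

/-! ### Affine varieties over `K` -/

/-- The Zariski topology on affine space `σ → K`: the closed sets are the zero loci of ideals. -/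
@[reducible] def zariski (K σ : Type*) [Field K] : TopologicalSpace (σ → K) :=
  TopologicalSpace.ofClosed {Z | ∃ I : Ideal (MvPolynomial σ K), Z = zeroLocus K I}
    ⟨⊤, by simp⟩
    (by
      intro A hA
      refine ⟨sSup {I | zeroLocus K I ∈ A}, ?_⟩
      ext x
      simp only [Set.mem_sInter]
      constructor
      · intro h
        have : sSup {I : Ideal (MvPolynomial σ K) | zeroLocus K I ∈ A} ≤ vanishingIdeal K {x} :=
          sSup_le fun I hI p hp => (mem_vanishingIdeal_singleton_iff x p).2 (h _ hI p hp)
        exact fun p hp => (mem_vanishingIdeal_singleton_iff x p).1 (this hp)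
      · intro h Z hZ
        obtain ⟨I, rfl⟩ := hA hZ
        exact fun p hp => h p ((le_sSup (show I ∈ {I | zeroLocus K I ∈ A} from hZ)) hp))
    (by
      rintro _ ⟨I, rfl⟩ _ ⟨J, rfl⟩
      refine ⟨I ⊓ J, ?_⟩
      ext x
      constructor
      · rintro (h | h) p hp
        · exact h p hp.1
        · exact h p hp.2
      · intro h
        by_contra hx
        simp only [Set.mem_union, mem_zeroLocus_iff, not_or, not_forall] at hx
        obtain ⟨⟨p, hp, hpx⟩, ⟨q, hq, hqx⟩⟩ := hx
        have := h (p * q) ⟨I.mul_mem_right _ hp, J.mul_mem_left _ hq⟩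
        rw [map_mul] at this
        exact (mul_ne_zero hpx hqx) this)

/-- `C` is an irreducible component of `V` (for the Zariski topology): a maximal irreducible
subset of `V`. -/
def IsComponent {K σ : Type*} [Field K] (V C : Set (σ → K)) : Prop :=
  Maximal (fun Z => @IsIrreducible _ (zariski K σ) Z ∧ Z ⊆ V) C

/-- The variables `U` are independent for the ideal `I`: `I ∩ K[U] = 0`. -/
def IsIndependent {K σ : Type*} [Field K] (U : Finset σ) (I : Ideal (MvPolynomial σ K)) : Prop :=
  I.comap (rename ((↑) : {i // i ∈ U} → σ) : MvPolynomial {i // i ∈ U} K →ₐ[K] MvPolynomial σ K)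
    = ⊥

/-- Every polynomial of `T` vanishes at every point of `C`. -/
def VanishesOn {K σ : Type*} [Field K] (T : Ideal (MvPolynomial σ K)) (C : Set (σ → K)) : Prop :=
  ∀ t ∈ T, ∀ x ∈ C, eval x t = 0

/-- `T` vanishes identically on some irreducible component of the variety of `H` on which the
variables `U` remain independent (no nonzero polynomial in `K[U]` vanishes on the component). -/
def VanishesOnSomeIndependentComponent {K σ : Type*} [Field K] (U : Finset σ)
    (H T : Ideal (MvPolynomial σ K)) : Prop :=
  ∃ C, IsComponent (zeroLocus K H) C ∧ IsIndependent U (vanishingIdeal K C) ∧ VanishesOn T C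

/-! ### Reduced Gröbner bases over a field -/

/-- `B` is the reduced Gröbner basis of the ideal `J` with respect to the monomial order `m`. -/
structure IsReducedGroebnerBasis {K τ : Type*} [Field K] (m : MonomialOrder τ)
    (J : Ideal (MvPolynomial τ K)) (B : Set (MvPolynomial τ K)) : Prop where
  finite : B.Finite
  subset : B ⊆ J
  exists_degree_le : ∀ f ∈ J, f ≠ 0 → ∃ b ∈ B, m.degree b ≤ m.degree f
  monic : ∀ b ∈ B, m.leadingCoeff b = 1
  reduced : ∀ b ∈ B, ∀ b' ∈ B, b ≠ b' → ∀ c ∈ b.support, ¬ m.degree b' ≤ c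

/-! ### Parametric ideals and comprehensive Gröbner systems

`π` is the type of parameters and `τ` the type of variables. -/

/-- The specialization `K[π][τ] → K[τ]` of the parameters at the point `u`. -/
def specialize {K π τ : Type*} [Field K] (u : π → K) :
    MvPolynomial τ (MvPolynomial π K) →+* MvPolynomial τ K :=
  MvPolynomial.map (eval u)

/-- A segment of a Gröbner system: a subset of the parameter space with its basis. -/
structure Segment (K π τ : Type*) [Field K] where
  carrier : Set (π → K)
  basis : Finset (MvPolynomial τ (MvPolynomial π K))

/-- The basis `B` is primitive (content `1` over `K[π]`, up to units), its leading power products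
are pairwise distinct, its leading coefficients vanish nowhere on the segment, and at every point
of the segment it specializes, after division by the (nonzero) leading coefficients,
to the reduced Gröbner basis of the specialized ideal. -/
structure Segment.IsReduced {K π τ : Type*} [Field K] (m : MonomialOrder τ)
    (I : Ideal (MvPolynomial τ (MvPolynomial π K))) (s : Segment K π τ) : Prop where
  primitive : ∀ b ∈ s.basis, ∀ c : MvPolynomial π K, C c ∣ b → IsUnit c
  injOn_degree : Set.InjOn m.degree (s.basis : Set (MvPolynomial τ (MvPolynomial π K)))
  leadingCoeff_ne_zero : ∀ b ∈ s.basis, ∀ u ∈ s.carrier, eval u (m.leadingCoeff b) ≠ 0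
  specializes : ∀ u ∈ s.carrier, IsReducedGroebnerBasis m (I.map (specialize u))
    ((fun b => C (eval u (m.leadingCoeff b))⁻¹ * specialize u b) '' (s.basis : Set _))

/-- A finite set of reduced segments that forms a partition of the parameter space into
(nonempty) constructible sets. -/
structure IsReducedGroebnerSystem {K π τ : Type*} [Field K] (m : MonomialOrder τ)
    (I : Ideal (MvPolynomial τ (MvPolynomial π K))) (G : Finset (Segment K π τ)) : Prop where
  constructible : ∀ s ∈ G, @Topology.IsConstructible _ (zariski K π) s.carrier
  nonempty : ∀ s ∈ G, s.carrier.Nonempty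
  disjoint : (G : Set (Segment K π τ)).PairwiseDisjoint Segment.carrier
  cover : ∀ u : π → K, ∃ s ∈ G, u ∈ s.carrier
  reduced : ∀ s ∈ G, s.IsReduced m I

/-- A minimal (canonical) comprehensive Gröbner system of `I`: a reduced Gröbner system with the
least number of segments. In particular no two segments can be merged, so that two segments
have no common basis and at most one segment has basis `1`. -/
structure IsMCCGS {K π τ : Type*} [Field K] (m : MonomialOrder τ)
    (I : Ideal (MvPolynomial τ (MvPolynomial π K))) (G : Finset (Segment K π τ)) : Prop where
  isReducedGroebnerSystem : IsReducedGroebnerSystem m I G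
  minimal : ∀ G' : Finset (Segment K π τ), IsReducedGroebnerSystem m I G' → G.card ≤ G'.card

/-- A segment is generic if it contains a nonempty Zariski-open subset of the parameter space. -/
def Segment.IsGeneric {K π τ : Type*} [Field K] (s : Segment K π τ) : Prop :=
  ∃ O : Set (π → K), @IsOpen _ (zariski K π) O ∧ O.Nonempty ∧ O ⊆ s.carrier

/-- The basis of the segment is `1`, up to the nonzero scalar of `K` that the normalization to
content `1` leaves free. -/
def Segment.BasisIsOne {K π τ : Type*} [Field K] (s : Segment K π τ) : Prop :=
  ∃ c : K, c ≠ 0 ∧ s.basis = {C (C c)}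

/-! ### Choosing some of the variables as parameters -/

open Classical in
/-- The isomorphism `K[X] → K[U][X ∖ U]`. -/
def toParametric (K : Type*) {σ : Type*} [Field K] (U : Finset σ) :
    MvPolynomial σ K →ₐ[K] MvPolynomial {i // i ∉ U} (MvPolynomial {i // i ∈ U} K) :=
  aeval fun i => if h : i ∈ U then C (X ⟨i, h⟩) else X ⟨i, h⟩

/-- The ideal `I` of `K[X]` seen as a parametric ideal, i.e. an ideal of `K[U][X ∖ U]`. -/
def parametricIdeal {K σ : Type*} [Field K] (U : Finset σ) (I : Ideal (MvPolynomial σ K)) :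
    Ideal (MvPolynomial {i // i ∉ U} (MvPolynomial {i // i ∈ U} K)) :=
  I.map (toParametric K U)

end ParametricGroebner

end

/-!
Write `I = H + T`. If `U` is independent for `I`, it stays so for some prime `P` minimal over `I`.
Then `dim K[X]/P ≥ |U| ≥ dim K[X]/H` leaves no room for a prime containing `H` strictly below `P`,
so `V(P)` is a component of `V(H)`.

For Gröbner systems, consider the projection of `V(I)` to the parameter space `K ^ U`. By the
Nullstellensatz its closure is cut out by `I ∩ K[U]`, so `U` is independent for `I` exactly when the
projection is dense. A point `u` lies in the projection exactly when `σ_u(I)` is proper, and on the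
whole of a segment this is decided by whether the basis is `1`; hence a generic segment either
lies in the projection, making it dense, or misses it, keeping it from being dense.
A generic segment exists and is unique because `K ^ U` is irreducible: some member of a finite
constructible cover has nonempty interior, and nonempty open sets meet.
-/

namespace ParametricGroebner

section KrullDimension

theorem ringKrullDim_le_of_isIntegral (R S : Type*) [CommRing R] [CommRing S] [Algebra R S]
    [Algebra.IsIntegral R S] [FaithfulSMul R S] : ringKrullDim R ≤ ringKrullDim S := by
  refine iSup_le fun chain => ?_
  obtain ⟨P, _, _⟩ := Ideal.nonempty_primesOver (S := S) chain.head.asIdeal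
  obtain ⟨lifted, hlength, -⟩ := Ideal.exists_ltSeries_of_hasGoingUp chain P
  exact hlength ▸ Order.LTSeries.length_le_krullDim lifted

theorem trdeg_le_ringKrullDim (k A : Type*) [Field k] [CommRing A] [IsDomain A]
    [Algebra k A] [Algebra.FiniteType k A] :
    ((Algebra.trdeg k A).toENat : WithBot ℕ∞) ≤ ringKrullDim A := by
  obtain ⟨n, g, hg, hgi⟩ := exists_integral_inj_algHom_of_fg k A
  algebraize [g.toRingHom]
  have : FaithfulSMul (MvPolynomial (Fin n) k) A :=
    (faithfulSMul_iff_algebraMap_injective _ _).2 hg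
  have : IsScalarTower k (MvPolynomial (Fin n) k) A := .of_algebraMap_eq' g.comp_algebraMap.symm
  have htrdeg : (Algebra.trdeg k A).toENat = n := by
    have := congrArg Cardinal.toENat (lift_trdeg_add_eq k (MvPolynomial (Fin n) k) A)
    simpa [trdeg_eq_zero (R := MvPolynomial (Fin n) k)] using this.symm
  calc ((Algebra.trdeg k A).toENat : WithBot ℕ∞) = n := by rw [htrdeg]; rfl
    _ = ringKrullDim (MvPolynomial (Fin n) k) := by
      simp [MvPolynomial.ringKrullDim_of_isNoetherianRing]
    _ ≤ ringKrullDim A := ringKrullDim_le_of_isIntegral _ _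

theorem ringKrullDim_quotient_add_one_le {R : Type*} [CommRing R] {P Q : Ideal R} [Q.IsPrime]
    (h : Q < P) : ringKrullDim (R ⧸ P) + 1 ≤ ringKrullDim (R ⧸ Q) := by
  obtain ⟨r, hrP, hrQ⟩ := Set.exists_of_ssubset h
  refine ringKrullDim_succ_le_of_surjective (Ideal.Quotient.factor h.le)
    (Ideal.Quotient.factor_surjective h.le) (r := Ideal.Quotient.mk Q r) ?_ ?_
  · exact mem_nonZeroDivisors_of_ne_zero (by rwa [Ne, Ideal.Quotient.eq_zero_iff_mem])
  · rwa [Ideal.Quotient.factor_mk, Ideal.Quotient.eq_zero_iff_mem]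

theorem mem_minimalPrimes_of_ringKrullDim_quotient_le {R : Type*} [CommRing R] {I P : Ideal R}
    [P.IsPrime] (hIP : I ≤ P) (hfinite : ringKrullDim (R ⧸ I) ≠ ⊤)
    (hdim : ringKrullDim (R ⧸ I) ≤ ringKrullDim (R ⧸ P)) : P ∈ I.minimalPrimes := by
  obtain ⟨Q, hQ, hQP⟩ := Ideal.exists_minimalPrimes_le hIP
  rcases hQP.eq_or_lt with rfl | hlt
  · exact hQ
  have := hQ.1.1
  have hQI : ringKrullDim (R ⧸ Q) ≤ ringKrullDim (R ⧸ I) :=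
    ringKrullDim_le_of_surjective (Ideal.Quotient.factor hQ.1.2)
      (Ideal.Quotient.factor_surjective hQ.1.2)
  have hsucc : ringKrullDim (R ⧸ I) + 1 ≤ ringKrullDim (R ⧸ I) :=
    calc ringKrullDim (R ⧸ I) + 1 ≤ ringKrullDim (R ⧸ P) + 1 := by gcongr
      _ ≤ ringKrullDim (R ⧸ Q) := ringKrullDim_quotient_add_one_le hlt
      _ ≤ ringKrullDim (R ⧸ I) := hQI
  have hbot : ringKrullDim (R ⧸ I) ≠ ⊥ :=
    ne_bot_of_le_ne_bot WithBot.coe_ne_bot (ringKrullDim_nonneg_of_nontrivial.trans hQI)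
  generalize ringKrullDim (R ⧸ I) = d at hsucc hfinite hbot
  lift d to ℕ∞ using hbot
  lift d to ℕ using by exact_mod_cast hfinite
  exact absurd (mod_cast hsucc) d.not_succ_le_self

end KrullDimension

section Constructible

variable {X : Type*} [TopologicalSpace X] [IrreducibleSpace X]

theorem interior_nonempty_or_interior_compl_nonempty {s : Set X}
    (hs : Topology.IsConstructible s) : (interior s).Nonempty ∨ (interior sᶜ).Nonempty := by
  induction hs using Topology.IsConstructible.empty_union_induction with
  | open_retrocompact V hV _ =>
    rcases V.eq_empty_or_nonempty with rfl | hne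
    · exact .inr (by simp)
    · exact .inl (by rwa [hV.interior_eq])
  | union s _ t _ hs ht =>
    rcases hs with hs | hs
    · exact .inl (hs.mono (interior_mono Set.subset_union_left))
    rcases ht with ht | ht
    · exact .inl (ht.mono (interior_mono Set.subset_union_right))
    · rw [Set.compl_union, interior_inter]
      exact .inr (nonempty_preirreducible_inter isOpen_interior isOpen_interior hs ht)
  | compl s _ hs => rwa [compl_compl, or_comm]

theorem interior_nonempty_or_of_interior_union_nonempty {s t : Set X}
    (hs : Topology.IsConstructible s) (hst : (interior (s ∪ t)).Nonempty) :
    (interior s).Nonempty ∨ (interior t).Nonempty := by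
  refine (interior_nonempty_or_interior_compl_nonempty hs).imp_right fun hsc => ?_
  have hne := nonempty_preirreducible_inter isOpen_interior isOpen_interior hst hsc
  rw [← interior_inter] at hne
  exact hne.mono (interior_mono (Set.union_inter_compl_left_subset s t))

theorem exists_interior_nonempty_of_biUnion {ι : Type*} {G : Finset ι} {f : ι → Set X}
    (hf : ∀ i ∈ G, Topology.IsConstructible (f i)) (hG : (interior (⋃ i ∈ G, f i)).Nonempty) :
    ∃ i ∈ G, (interior (f i)).Nonempty := by
  induction G using Finset.cons_induction with
  | empty => simp at hG
  | cons i G hi ih =>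
    simp only [Finset.mem_cons, Set.iUnion_iUnion_eq_or_left, forall_eq_or_imp,
      exists_eq_or_imp] at hf hG ⊢
    exact (interior_nonempty_or_of_interior_union_nonempty hf.1 hG).imp_right (ih hf.2)

end Constructible

section Zariski

attribute [local instance] zariski

variable {K σ : Type*} [Field K]

theorem isClosed_iff_exists_eq_zeroLocus {Z : Set (σ → K)} :
    IsClosed Z ↔ ∃ I : Ideal (MvPolynomial σ K), Z = zeroLocus K I := by
  rw [← isOpen_compl_iff]
  change Zᶜᶜ ∈ {Z | ∃ I : Ideal (MvPolynomial σ K), Z = zeroLocus K I} ↔ _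
  rw [compl_compl, Set.mem_ofPred_eq]

theorem isClosed_zeroLocus (I : Ideal (MvPolynomial σ K)) : IsClosed (zeroLocus K I) :=
  isClosed_iff_exists_eq_zeroLocus.2 ⟨I, rfl⟩

theorem closure_eq_zeroLocus_vanishingIdeal (S : Set (σ → K)) :
    closure S = zeroLocus K (vanishingIdeal K S) := by
  refine (closure_minimal (zeroLocus_vanishingIdeal_le S) (isClosed_zeroLocus _)).antisymm ?_
  obtain ⟨I, hI⟩ := isClosed_iff_exists_eq_zeroLocus.1 (isClosed_closure (s := S))
  rw [hI]
  exact zeroLocus_anti_mono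
    (le_zeroLocus_iff_le_vanishingIdeal.1 (subset_closure.trans hI.subset))

theorem isIrreducible_iff_isPrime_vanishingIdeal {Z : Set (σ → K)} :
    IsIrreducible Z ↔ (vanishingIdeal K Z).IsPrime := by
  rw [IsIrreducible, isPreirreducible_iff_isClosed_union_isClosed]
  constructor
  · rintro ⟨⟨z, hz⟩, hirr⟩
    refine ⟨fun htop => ?_, fun {p q} hpq => ?_⟩
    · have : (1 : MvPolynomial σ K) ∈ vanishingIdeal K Z := htop ▸ Submodule.mem_top
      simpa using this z hz
    · have := hirr _ _ (isClosed_zeroLocus (.span {p})) (isClosed_zeroLocus (.span {q}))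
        fun x hx => by simpa [zeroLocus_span] using hpq x hx
      simpa [zeroLocus_span, Set.subset_def] using this
  · intro hprime
    refine ⟨Set.nonempty_iff_ne_empty.2 fun hempty => ?_, fun Z₁ Z₂ hZ₁ hZ₂ hsub => ?_⟩
    · exact hprime.ne_top (by rw [hempty, vanishingIdeal_empty])
    obtain ⟨I, rfl⟩ := isClosed_iff_exists_eq_zeroLocus.1 hZ₁
    obtain ⟨J, rfl⟩ := isClosed_iff_exists_eq_zeroLocus.1 hZ₂
    have hmul : I * J ≤ vanishingIdeal K Z := Ideal.mul_le.2 fun p hp q hq x hx => by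
      rw [map_mul, mul_eq_zero]
      exact (hsub hx).imp (· p hp) (· q hq)
    exact (hprime.mul_le.1 hmul).imp le_zeroLocus_iff_le_vanishingIdeal.2
      le_zeroLocus_iff_le_vanishingIdeal.2

theorem isComponent_zeroLocus [IsAlgClosed K] [Finite σ] {H P : Ideal (MvPolynomial σ K)}
    (hP : P ∈ H.minimalPrimes) : IsComponent (zeroLocus K H) (zeroLocus K P) := by
  have := hP.1.1
  have hvanish : vanishingIdeal K (zeroLocus K P) = P := IsPrime.vanishingIdeal_zeroLocus P
  refine ⟨⟨isIrreducible_iff_isPrime_vanishingIdeal.2 (by rwa [hvanish]),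
    zeroLocus_anti_mono hP.1.2⟩, fun Z ⟨hZ, hZH⟩ hPZ => ?_⟩
  exact le_zeroLocus_iff_le_vanishingIdeal.2
    (hP.2 ⟨isIrreducible_iff_isPrime_vanishingIdeal.1 hZ, le_zeroLocus_iff_le_vanishingIdeal.1 hZH⟩
      ((vanishingIdeal_anti_mono hPZ).trans hvanish.le))

theorem zeroLocus_nonempty_iff_ne_top [IsAlgClosed K] [Finite σ]
    {I : Ideal (MvPolynomial σ K)} :
    (zeroLocus K I).Nonempty ↔ I ≠ ⊤ := by
  rw [Set.nonempty_iff_ne_empty, not_iff_not]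
  constructor
  · intro h
    rw [← Ideal.radical_eq_top, ← vanishingIdeal_zeroLocus_eq_radical (K := K), h,
      vanishingIdeal_empty]
  · rintro rfl
    simp

variable [Infinite K]

theorem vanishingIdeal_univ : vanishingIdeal K (Set.univ : Set (σ → K)) = ⊥ :=
  (Submodule.eq_bot_iff _).2 fun p hp =>
    MvPolynomial.funext fun x => by simpa [aeval_eq_eval] using hp x trivial

theorem irreducibleSpace_zariski : IrreducibleSpace (σ → K) :=
  (irreducibleSpace_def _).2 <| isIrreducible_iff_isPrime_vanishingIdeal.2 <| by
    rw [Set.top_eq_univ, vanishingIdeal_univ]; exact Ideal.isPrime_bot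

theorem dense_iff_vanishingIdeal_eq_bot {S : Set (σ → K)} :
    Dense S ↔ vanishingIdeal K S = ⊥ := by
  rw [dense_iff_closure_eq, closure_eq_zeroLocus_vanishingIdeal]
  constructor
  · intro h
    rw [← le_bot_iff, ← vanishingIdeal_univ (K := K), ← h]
    exact le_vanishingIdeal_zeroLocus _
  · intro h
    rw [h, zeroLocus_bot, Set.top_eq_univ]

end Zariski

section Independent

variable {K σ : Type*} [Field K] {U : Finset σ} {H T I J : Ideal (MvPolynomial σ K)}

theorem IsIndependent.mono (hJ : IsIndependent U J) (h : I ≤ J) : IsIndependent U I :=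
  le_bot_iff.1 ((Ideal.comap_mono h).trans hJ.le)

theorem IsIndependent.exists_mem_minimalPrimes (hI : IsIndependent U I) :
    ∃ P ∈ I.minimalPrimes, IsIndependent U P := by
  have hbot : ⊥ ∈ (I.comap (rename ((↑) : {i // i ∈ U} → σ))).minimalPrimes := by
    rw [hI, Ideal.minimalPrimes_eq_subsingleton_self]
    rfl
  exact Ideal.exists_minimalPrimes_comap_eq _ ⊥ hbot

theorem isIndependent_iff_algebraicIndependent :
    IsIndependent U I ↔
      AlgebraicIndependent K fun i : {i // i ∈ U} => Ideal.Quotient.mk I (X (i : σ)) := by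
  rw [algebraicIndependent_iff]
  have haeval (p : MvPolynomial {i // i ∈ U} K) :
      aeval (fun i : {i // i ∈ U} => Ideal.Quotient.mk I (X (i : σ))) p =
        Ideal.Quotient.mk I (rename (↑) p) := by
    simpa [Function.comp_def] using (DFunLike.congr_fun
      (aeval_unique ((Ideal.Quotient.mkₐ K I).comp (rename ((↑) : {i // i ∈ U} → σ)))) p).symm
  simp only [haeval, Ideal.Quotient.eq_zero_iff_mem]
  exact Submodule.eq_bot_iff _

theorem IsIndependent.card_le_ringKrullDim [Finite σ] {P : Ideal (MvPolynomial σ K)} [P.IsPrime]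
    (hP : IsIndependent U P) : (U.card : WithBot ℕ∞) ≤ ringKrullDim (MvPolynomial σ K ⧸ P) := by
  refine le_trans ?_ (trdeg_le_ringKrullDim K _)
  have hcard := (isIndependent_iff_algebraicIndependent.1 hP).lift_cardinalMk_le_trdeg
  exact WithBot.coe_le_coe.2 (Cardinal.natCast_le_toENat.2 (by simpa using hcard))

theorem vanishesOn_iff_le_vanishingIdeal {C : Set (σ → K)} :
    VanishesOn T C ↔ T ≤ vanishingIdeal K C := by
  simp only [VanishesOn, SetLike.le_def, mem_vanishingIdeal_iff, aeval_eq_eval]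

theorem vanishesOnSomeIndependentComponent_iff [IsAlgClosed K] [Finite σ]
    (hdim : ringKrullDim (MvPolynomial σ K ⧸ H) ≤ U.card) :
    VanishesOnSomeIndependentComponent U H T ↔ IsIndependent U (H ⊔ T) := by
  constructor
  · rintro ⟨C, hC, hUC, hT⟩
    exact hUC.mono (sup_le (le_zeroLocus_iff_le_vanishingIdeal.1 hC.1.2)
      (vanishesOn_iff_le_vanishingIdeal.1 hT))
  · intro hHT
    obtain ⟨P, ⟨⟨_, hHTP⟩, -⟩, hUP⟩ := hHT.exists_mem_minimalPrimes
    have hHP : H ≤ P := le_sup_left.trans hHTP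
    have hfinite : ringKrullDim (MvPolynomial σ K ⧸ H) ≠ ⊤ :=
      (hdim.trans_lt (WithBot.coe_lt_coe.2 (ENat.natCast_lt_top _))).ne
    have hmin : P ∈ H.minimalPrimes :=
      mem_minimalPrimes_of_ringKrullDim_quotient_le hHP hfinite
        (hdim.trans hUP.card_le_ringKrullDim)
    have hvanish : vanishingIdeal K (zeroLocus K P) = P := IsPrime.vanishingIdeal_zeroLocus P
    refine ⟨zeroLocus K P, isComponent_zeroLocus hmin, by rwa [hvanish], ?_⟩
    rw [vanishesOn_iff_le_vanishingIdeal, hvanish]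
    exact le_sup_right.trans hHTP

attribute [local instance] zariski in
theorem isIndependent_iff_dense [IsAlgClosed K] [Finite σ] :
    IsIndependent U I ↔ Dense ((fun x (i : {i // i ∈ U}) => x i) '' zeroLocus K I) := by
  have hcomap : vanishingIdeal K ((fun x (i : {i // i ∈ U}) => x i) '' zeroLocus K I) =
      (I.comap (rename ((↑) : {i // i ∈ U} → σ))).radical := by
    rw [← Ideal.comap_radical, ← vanishingIdeal_zeroLocus_eq_radical (K := K)]
    ext p
    simp only [mem_vanishingIdeal_iff, Set.forall_mem_image, Ideal.mem_comap, aeval_eq_eval,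
      eval_rename, Function.comp_def]
  rw [dense_iff_vanishingIdeal_eq_bot, hcomap]
  refine ⟨fun h => ?_, fun h => le_bot_iff.1 (Ideal.le_radical.trans h.le)⟩
  rw [show I.comap _ = ⊥ from h, Ideal.radical_bot_of_isReduced]

end Independent

section Specialization

variable {K σ : Type*} [Field K] {U : Finset σ}

theorem eval_specialize_toParametric (x : σ → K) (p : MvPolynomial σ K) :
    eval (fun i : {i // i ∉ U} => x i) (specialize (fun i : {i // i ∈ U} => x i)
      (toParametric K U p)) = eval x p := by
  induction p using MvPolynomial.induction_on with
  | C a => simp [toParametric, specialize, algebraMap_eq]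
  | add p q hp hq => simp [hp, hq]
  | mul_X p i hp =>
    rw [map_mul, map_mul, map_mul, map_mul, hp]
    by_cases h : i ∈ U <;> simp [toParametric, h, specialize]

theorem mem_zeroLocus_map_specialize_iff {I : Ideal (MvPolynomial σ K)} {x : σ → K} :
    (fun i : {i // i ∉ U} => x i) ∈
      zeroLocus K ((parametricIdeal U I).map (specialize fun i : {i // i ∈ U} => x i)) ↔
      x ∈ zeroLocus K I := by
  rw [← Set.singleton_subset_iff, ← Set.singleton_subset_iff (s := zeroLocus K I),
    le_zeroLocus_iff_le_vanishingIdeal, le_zeroLocus_iff_le_vanishingIdeal, parametricIdeal,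
    Ideal.map_le_iff_le_comap, Ideal.map_le_iff_le_comap]
  simp only [SetLike.le_def, Ideal.mem_comap, mem_vanishingIdeal_singleton_iff, aeval_eq_eval,
    eval_specialize_toParametric]

theorem setOf_map_specialize_parametricIdeal_ne_top [IsAlgClosed K] [Finite σ]
    (I : Ideal (MvPolynomial σ K)) :
    {u | (parametricIdeal U I).map (specialize u) ≠ ⊤} =
      (fun x (i : {i // i ∈ U}) => x i) '' zeroLocus K I := by
  ext u
  rw [Set.mem_ofPred_eq, ← zeroLocus_nonempty_iff_ne_top]
  constructor
  · rintro ⟨y, hy⟩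
    classical
    obtain ⟨x, hx⟩ := (Equiv.piEquivPiSubtypeProd (· ∈ U) fun _ => K).surjective (u, y)
    obtain ⟨rfl, rfl⟩ := Prod.mk.inj hx
    exact ⟨x, mem_zeroLocus_map_specialize_iff.1 hy, rfl⟩
  · rintro ⟨x, hx, rfl⟩
    exact ⟨_, mem_zeroLocus_map_specialize_iff.2 hx⟩

end Specialization

section UnitIdeal

theorem degree_map_of_leadingCoeff_ne_zero {R S τ : Type*} [CommSemiring R] [CommSemiring S]
    (m : MonomialOrder τ) (f : R →+* S) {p : MvPolynomial τ R} (hp : f (m.leadingCoeff p) ≠ 0) :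
    m.degree (map f p) = m.degree p := by
  apply m.toSyn.injective
  apply le_antisymm
  · exact m.degree_le_iff.2 fun d hd => m.le_degree (support_map_subset f p hd)
  · exact m.le_degree (by rwa [mem_support_iff, coeff_map])

theorem IsReducedGroebnerBasis.eq_singleton_one_iff {K τ : Type*} [Field K] {m : MonomialOrder τ}
    {J : Ideal (MvPolynomial τ K)} {B : Set (MvPolynomial τ K)}
    (hB : IsReducedGroebnerBasis m J B) : B = {1} ↔ J = ⊤ := by
  constructor
  · rintro rfl
    exact (Ideal.eq_top_iff_one _).2 (hB.subset rfl)
  rintro rfl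
  obtain ⟨b, hb, hdeg⟩ := hB.exists_degree_le 1 Submodule.mem_top one_ne_zero
  obtain rfl : b = 1 := by
    rw [m.degree_one, nonpos_iff_eq_zero] at hdeg
    rw [m.eq_C_of_degree_eq_zero hdeg, hB.monic b hb, C_1]
  refine Set.eq_singleton_iff_unique_mem.2 ⟨hb, fun b hb' => ?_⟩
  by_contra hne
  have hb0 : b ≠ 0 := by
    rintro rfl
    simpa using hB.monic 0 hb'
  exact hB.reduced b hb' 1 hb hne _ (m.degree_mem_support hb0) (by simp)

variable {K π τ : Type*} [Field K] {m : MonomialOrder τ}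
  {I : Ideal (MvPolynomial τ (MvPolynomial π K))} {s : Segment K π τ}

theorem Segment.IsReduced.exists_eq_C_C (hs : s.IsReduced m I)
    {b : MvPolynomial τ (MvPolynomial π K)} (hb : b ∈ s.basis) (hdeg : m.degree b = 0) :
    ∃ c : K, c ≠ 0 ∧ b = C (C c) := by
  have hbC := m.eq_C_of_degree_eq_zero hdeg
  have hunit := hs.primitive b hb (m.leadingCoeff b) (by rw [← hbC])
  obtain ⟨c, hc, hcb⟩ := MvPolynomial.isUnit_iff_eq_C_of_isReduced.1 hunit
  exact ⟨c, hc.ne_zero, by rw [← hcb, ← hbC]⟩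

theorem Segment.IsReduced.basisIsOne_iff_degree (hs : s.IsReduced m I) :
    s.BasisIsOne ↔ s.basis.Nonempty ∧ ∀ b ∈ s.basis, m.degree b = 0 := by
  constructor
  · rintro ⟨c, -, hB⟩
    simp [hB]
  · rintro ⟨⟨b, hb⟩, hdeg⟩
    obtain ⟨c, hc, rfl⟩ := hs.exists_eq_C_C hb (hdeg b hb)
    exact ⟨c, hc, Finset.eq_singleton_iff_unique_mem.2 ⟨hb, fun b hb' =>
      hs.injOn_degree hb' hb ((hdeg b hb').trans (hdeg _ hb).symm)⟩⟩

theorem C_inv_mul_specialize_eq_one_iff {b : MvPolynomial τ (MvPolynomial π K)} {u : π → K}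
    (hu : eval u (m.leadingCoeff b) ≠ 0) :
    C (eval u (m.leadingCoeff b))⁻¹ * specialize u b = 1 ↔ m.degree b = 0 := by
  constructor
  · intro h
    have hspec : specialize u b = C (eval u (m.leadingCoeff b)) := by
      rw [← mul_one (C _), ← h, ← mul_assoc, ← C_mul, mul_inv_cancel₀ hu, C_1, one_mul]
    rw [← degree_map_of_leadingCoeff_ne_zero m (eval u) hu]
    exact hspec ▸ m.degree_C _
  · intro h
    have hspec : specialize u b = C (eval u (m.leadingCoeff b)) := by
      conv_lhs => rw [m.eq_C_of_degree_eq_zero h, specialize, map_C]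
    rw [hspec, ← C_mul, inv_mul_cancel₀ hu, C_1]

theorem Segment.IsReduced.basisIsOne_iff_map_specialize_eq_top (hs : s.IsReduced m I) {u : π → K}
    (hu : u ∈ s.carrier) : s.BasisIsOne ↔ I.map (specialize u) = ⊤ := by
  rw [← (hs.specializes u hu).eq_singleton_one_iff, hs.basisIsOne_iff_degree,
    Set.eq_singleton_iff_nonempty_unique_mem, Set.image_nonempty, Finset.coe_nonempty,
    Set.forall_mem_image]
  exact and_congr_right' (forall₂_congr fun b hb =>
    (C_inv_mul_specialize_eq_one_iff (hs.leadingCoeff_ne_zero b hb u hu)).symm)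

end UnitIdeal

section Generic

attribute [local instance] zariski

variable {K π τ : Type*} [Field K] {m : MonomialOrder τ}
  {I : Ideal (MvPolynomial τ (MvPolynomial π K))} {s : Segment K π τ}

theorem Segment.isGeneric_iff_interior_nonempty :
    s.IsGeneric ↔ (interior s.carrier).Nonempty :=
  ⟨fun ⟨_, hO, hne, hOs⟩ => hne.mono (interior_maximal hOs hO),
    fun h => ⟨_, isOpen_interior, h, interior_subset⟩⟩

variable [Infinite K]

theorem IsReducedGroebnerSystem.existsUnique_isGeneric {G : Finset (Segment K π τ)}
    (hG : IsReducedGroebnerSystem m I G) : ∃! s, s ∈ G ∧ s.IsGeneric := by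
  have := irreducibleSpace_zariski (K := K) (σ := π)
  simp only [Segment.isGeneric_iff_interior_nonempty]
  have hcover : ⋃ s ∈ G, s.carrier = Set.univ :=
    Set.eq_univ_of_forall fun u => by simpa using hG.cover u
  obtain ⟨s, hs, hgen⟩ := exists_interior_nonempty_of_biUnion hG.constructible
    (by rw [hcover, interior_univ]; exact Set.univ_nonempty)
  refine ⟨s, ⟨hs, hgen⟩, fun t ⟨ht, htgen⟩ => ?_⟩
  obtain ⟨u, hut, hus⟩ := nonempty_preirreducible_inter isOpen_interior isOpen_interior htgen hgen
  exact hG.disjoint.elim_set ht hs u (interior_subset hut) (interior_subset hus)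

theorem Segment.IsReduced.basisIsOne_iff_not_dense (hs : s.IsReduced m I) (hgen : s.IsGeneric) :
    s.BasisIsOne ↔ ¬ Dense {u | I.map (specialize u) ≠ ⊤} := by
  have := irreducibleSpace_zariski (K := K) (σ := π)
  obtain ⟨O, hO, hne, hOs⟩ := hgen
  constructor
  · intro hone hdense
    obtain ⟨u, hu, hproper⟩ := hdense.inter_open_nonempty O hO hne
    exact hproper ((hs.basisIsOne_iff_map_specialize_eq_top (hOs hu)).1 hone)
  · intro hdense
    by_contra hone
    refine hdense ((hO.dense hne).mono fun u hu htop => hone ?_)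
    exact (hs.basisIsOne_iff_map_specialize_eq_top (hOs hu)).2 htop

end Generic

theorem Segment.IsReduced.basisIsOne_iff_not_isIndependent {K σ : Type*} [Field K]
    [IsAlgClosed K] [Finite σ] {U : Finset σ} {I : Ideal (MvPolynomial σ K)}
    {m : MonomialOrder {i // i ∉ U}} {s : Segment K {i // i ∈ U} {i // i ∉ U}}
    (hs : s.IsReduced m (parametricIdeal U I)) (hgen : s.IsGeneric) :
    s.BasisIsOne ↔ ¬ IsIndependent U I := by
  rw [hs.basisIsOne_iff_not_dense hgen, setOf_map_specialize_parametricIdeal_ne_top,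
    isIndependent_iff_dense]

end ParametricGroebner

open ParametricGroebner in
theorem proposition8_general {K σ : Type*} [Field K] [IsAlgClosed K] [Finite σ]
    (H T : Ideal (MvPolynomial σ K)) (U : Finset σ)
    (hdim : ringKrullDim (MvPolynomial σ K ⧸ H) ≤ U.card)
    (m : MonomialOrder {i // i ∉ U}) :
    (VanishesOnSomeIndependentComponent U H T ↔ IsIndependent U (H ⊔ T)) ∧
    ∀ G : Finset (Segment K {i // i ∈ U} {i // i ∉ U}),
      IsReducedGroebnerSystem m (parametricIdeal U (H ⊔ T)) G →
        (∃! s, s ∈ G ∧ s.IsGeneric) ∧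
        ∀ s ∈ G, s.IsGeneric →
          (VanishesOnSomeIndependentComponent U H T ↔ ¬ s.BasisIsOne) := by
  have hiff : VanishesOnSomeIndependentComponent U H T ↔ IsIndependent U (H ⊔ T) :=
    vanishesOnSomeIndependentComponent_iff hdim
  refine ⟨hiff, fun G hG => ⟨hG.existsUnique_isGeneric, fun s hs hgen => ?_⟩⟩
  rw [hiff, (hG.reduced s hs).basisIsOne_iff_not_isIndependent hgen, not_not]

open ParametricGroebner in
theorem proposition8 {K σ : Type*} [Field K] [IsAlgClosed K] [Finite σ]
    (H T : Ideal (MvPolynomial σ K)) (U : Finset σ) (hU : IsIndependent U H)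
    (hdim : ringKrullDim (MvPolynomial σ K ⧸ H) = U.card)
    (m : MonomialOrder {i // i ∉ U}) :
    (VanishesOnSomeIndependentComponent U H T ↔ IsIndependent U (H ⊔ T)) ∧
    ∀ G : Finset (Segment K {i // i ∈ U} {i // i ∉ U}),
      IsMCCGS m (parametricIdeal U (H ⊔ T)) G →
        (∃! s, s ∈ G ∧ s.IsGeneric) ∧
        ∀ s ∈ G, s.IsGeneric →
          (VanishesOnSomeIndependentComponent U H T ↔ ¬ s.BasisIsOne) :=
  (proposition8_general H T U hdim.le m).imp_right fun h G hG => h G hG.isReducedGroebnerSystem
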